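/- **Theorem 2.7.** There is an absolute constant $C>0$ such that for all real $\kappa\ge 1$ and $0<\varepsilon\le\frac12$ there is a number $k$ of iterations, depending only on $\kappa$ and $\varepsilon$, with the following property. Let $M\in\mathbb{C}^{n\times n}$ be a (Hermitian) positive definite matrix whose Euclidean condition number satisfies $\kappa(M)=\Vert M\Vert\,\Vert M^{-1}\Vert\le\kappa$, let $s_1,\dots,s_r$ be distinct indices in $\{1,\dots,n\}$, and let $D=\big((M^{-1})_{s_i s_j}\big)_{i,j=1}^{r}$ be the corresponding $r\times r$ block on the diagonal of $M^{-1}$. Then $k$ iterations of the block Lanczos algorithm in exact arithmetic, started with the block $B=(e_{s_1},\dots,e_{s_r})$ and accessing $M$ only through matrix–vector products, use at most $$C\, r\,\sqrt{\kappa}\,\log(1/\varepsilon)$$ matrix–vector products with $M$ and return a matrix $\widetilde D\in\mathbb{C}^{r\times r}$ with relative error at most $\varepsilon$: $$\Vert \widetilde D-D\Vert\le\varepsilon\,\Vert D\Vert .$$ Here $\Vert\cdot\Vert$ is the operator norm. Block Lanczos with $k$ iterations computes, one block at a time, an orthonormal basis $Q$ of the block Krylov subspace $\mathrm{span}\{M^j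 e_{s_i} : 0\le j<k,\ 1\le i\le r\}$ and the products $MQ$, where linearly dependent vectors are dropped, and returns $\widetilde D=(Q^*B)^*\,(Q^*MQ)^{-1}\,(Q^*B)$. In particular, with $\kappa=\kappa(M)$ for $n\ge1$, the number of products is $O\big(r\sqrt{\kappa(M)}\log(1/\varepsilon)\big)$. -/

import Mathlib

open scoped ComplexOrder Matrix.Norms.L2Operator

/-- Deterministic adaptive algorithms whose only access to an unknown complex `n × n` matrix `M`
is through matrix–vector products `v ↦ M v`.  Such an algorithm either stops with a result, or
names a vector `v` and continues in a way that depends on the answer `M v`. -/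
inductive MatVecAlgorithm (n : ℕ) (α : Type) : Type
  | done (a : α) : MatVecAlgorithm n α
  | product (v : EuclideanSpace ℂ (Fin n))
      (next : EuclideanSpace ℂ (Fin n) → MatVecAlgorithm n α) : MatVecAlgorithm n α

namespace MatVecAlgorithm

variable {n : ℕ} {α β : Type}

/-- Sequential composition. -/
def bind : MatVecAlgorithm n α → (α → MatVecAlgorithm n β) → MatVecAlgorithm n β
  | done a, f => f a
  | product v next, f => product v fun w => (next w).bind f

/-- The result of the algorithm when the unknown matrix is `M`. -/
noncomputable def result (M : Matrix (Fin n) (Fin n) ℂ) : MatVecAlgorithm n α → α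
  | done a => a
  | product v next => (next (Matrix.toEuclideanLin M v)).result M

/-- The number of matrix–vector products with `M` that the algorithm performs
when the unknown matrix is `M`. -/
noncomputable def numProducts (M : Matrix (Fin n) (Fin n) ℂ) : MatVecAlgorithm n α → ℕ
  | done _ => 0
  | product v next => (next (Matrix.toEuclideanLin M v)).numProducts M + 1

/-- Multiply each vector of a list by `M`, one product per vector; the result is the list of the
pairs `(q, M q)`. -/
def multiplyAll : List (EuclideanSpace ℂ (Fin n)) →
    MatVecAlgorithm n (List (EuclideanSpace ℂ (Fin n) × EuclideanSpace ℂ (Fin n)))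
  | [] => done []
  | q :: Q => product q fun w => (multiplyAll Q).bind fun P => done ((q, w) :: P)

end MatVecAlgorithm

namespace BlockLanczos

variable {n : ℕ}

open Classical in
/-- Gram–Schmidt: given a list `Q` of orthonormal vectors and a list `W`, the list of new
orthonormal vectors, orthogonal to `Q`, which together with `Q` span the same space as `Q` and `W`.
Vectors that depend linearly on the earlier ones are dropped (deflation). -/
noncomputable def orthonormalize (Q : List (EuclideanSpace ℂ (Fin n))) :
    List (EuclideanSpace ℂ (Fin n)) → List (EuclideanSpace ℂ (Fin n))
  | [] => []
  | w :: W =>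
    let u := w - (Q.map fun q => inner ℂ q w • q).sum
    if u = 0 then orthonormalize Q W
    else ((‖u‖⁻¹ : ℝ) : ℂ) • u ::
      orthonormalize (Q ++ [((‖u‖⁻¹ : ℝ) : ℂ) • u]) W

/-- `k` further iterations of block Lanczos, with full orthogonalization (in exact arithmetic it
yields the same blocks as the three-term recurrence, for Hermitian `M`).  The list `P` holds the
pairs `(q, M q)` for the orthonormal vectors `q` found so far, and `W` is the block to be
orthonormalized next.  One iteration orthonormalizes `W` against the vectors found so far,
multiplies every new vector by `M`, and passes these products on as the next block. -/
noncomputable def iterate : ℕ →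
    List (EuclideanSpace ℂ (Fin n) × EuclideanSpace ℂ (Fin n)) → List (EuclideanSpace ℂ (Fin n)) →
    MatVecAlgorithm n (List (EuclideanSpace ℂ (Fin n) × EuclideanSpace ℂ (Fin n)))
  | 0, P, _ => .done P
  | k + 1, P, W =>
    (MatVecAlgorithm.multiplyAll (orthonormalize (P.map Prod.fst) W)).bind fun N =>
      iterate k (P ++ N) (N.map Prod.snd)

/-- With `Q` the matrix whose columns are the orthonormal vectors `q`, and `T = Qᴴ M Q`, the
estimate `(Qᴴ B)ᴴ T⁻¹ (Qᴴ B)` of the quadratic form `Bᴴ M⁻¹ B`.  Only the pairs `(q, M q)` are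
used. -/
noncomputable def estimate {r : ℕ} (B : Fin r → EuclideanSpace ℂ (Fin n))
    (P : List (EuclideanSpace ℂ (Fin n) × EuclideanSpace ℂ (Fin n))) :
    Matrix (Fin r) (Fin r) ℂ :=
  let T : Matrix (Fin P.length) (Fin P.length) ℂ :=
    Matrix.of fun a b => inner ℂ (P.get a).1 (P.get b).2
  let QB : Matrix (Fin P.length) (Fin r) ℂ := Matrix.of fun a i => inner ℂ (P.get a).1 (B i)
  QB.conjTranspose * T⁻¹ * QB

end BlockLanczos

/-- The block Lanczos algorithm with `k` iterations and the starting block with columns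
`B 0, …, B (r - 1)`.  It builds an orthonormal basis of the block Krylov subspace
`span {M ^ j (B i) | j < k, i < r}` and returns the resulting estimate of `Bᴴ M⁻¹ B`. -/
noncomputable def blockLanczos {n r : ℕ} (B : Fin r → EuclideanSpace ℂ (Fin n)) (k : ℕ) :
    MatVecAlgorithm n (Matrix (Fin r) (Fin r) ℂ) :=
  (BlockLanczos.iterate k [] (List.ofFn B)).bind fun P => .done (BlockLanczos.estimate B P)

/-- The Euclidean condition number `‖M‖ ‖M⁻¹‖` of an invertible matrix, for the operator norm. -/
noncomputable def conditionNumber {n : ℕ} (M : Matrix (Fin n) (Fin n) ℂ) : ℝ :=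
  ‖M‖ * ‖M⁻¹‖

/-!
The matrix returned by block Lanczos is the Galerkin approximation of `Bᴴ * M⁻¹ * B` on the block
Krylov space, and completing the square in `Vᴴ * M * V` shows that it is optimal there: it lies
below `Bᴴ * M⁻¹ * B`, and the error is at most `(M⁻¹ * B - V)ᴴ * M * (M⁻¹ * B - V)` for every block
`V` with columns in that space. Take `V = q(M) * B` with `deg q < k`. If `|1 - x * q(x)| ≤ δ` on the
spectrum of `M`, the functional calculus bounds the error by `δ ^ 2 • Bᴴ * M⁻¹ * B`; shifted
and rescaled Chebyshev polynomials give `δ = 2 * exp (-k / √κ)`.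
-/

section Chebyshev

open Polynomial

theorem one_div_le_log_add_one_div_sub_one {s : ℝ} (hs : 1 < s) :
    1 / s ≤ Real.log ((s + 1) / (s - 1)) := by
  have hs₁ : 0 < s - 1 := sub_pos.2 hs
  have hs₂ : 0 < s + 1 := by linarith
  calc 1 / s ≤ 1 - ((s + 1) / (s - 1))⁻¹ := by
        rw [inv_div, one_sub_div hs₂.ne', div_le_div_iff₀ (by linarith) hs₂]
        linarith
    _ ≤ Real.log ((s + 1) / (s - 1)) := Real.one_sub_inv_le_log_of_pos (div_pos hs₂ hs₁)

theorem exp_div_two_le_cosh (x : ℝ) : Real.exp x / 2 ≤ Real.cosh x := by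
  rw [Real.cosh_eq]
  linarith [Real.exp_pos (-x)]

theorem exp_div_sqrt_div_two_le_eval_T {κ : ℝ} (hκ : 1 < κ) (k : ℕ) :
    Real.exp (k / √κ) / 2 ≤ (Chebyshev.T ℝ k).eval ((κ + 1) / (κ - 1)) := by
  set s := √κ
  have hsκ : s ^ 2 = κ := Real.sq_sqrt (by linarith)
  have hs₁ : 1 < s := Real.lt_sqrt zero_le_one |>.2 (by simpa using hκ)
  have hs₂ : s - 1 ≠ 0 := (sub_pos.2 hs₁).ne'
  set t := Real.log ((s + 1) / (s - 1))
  have hcosh : Real.cosh t = (κ + 1) / (κ - 1) := by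
    have hs₃ : s ^ 2 - 1 ≠ 0 := by nlinarith
    rw [Real.cosh_log (div_pos (by linarith) (by linarith)), ← hsκ]
    field_simp
    ring
  calc Real.exp (k / s) / 2 ≤ Real.exp (k * t) / 2 := by
        rw [div_eq_mul_one_div (k : ℝ) s]
        gcongr
        exact one_div_le_log_add_one_div_sub_one hs₁
    _ ≤ Real.cosh (k * t) := exp_div_two_le_cosh _
    _ = (Chebyshev.T ℝ k).eval ((κ + 1) / (κ - 1)) := by simp [← hcosh]

theorem exists_polynomial_eval_zero_eq_one_abs_le {a b : ℝ} (ha : 0 < a) (hab : a < b) (k : ℕ) :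
    ∃ p : ℝ[X], p.natDegree ≤ k ∧ p.eval 0 = 1 ∧
      ∀ x ∈ Set.Icc a b, |p.eval x| ≤ 2 * Real.exp (-(k / √(b / a))) := by
  have hba : 0 < b - a := sub_pos.2 hab
  set T := Chebyshev.T ℝ k
  set ℓ : ℝ[X] := C ((b + a) / (b - a)) - C (2 / (b - a)) * X
  set τ := T.eval (ℓ.eval 0) with hτ
  have hℓ : ∀ x ∈ Set.Icc a b, |ℓ.eval x| ≤ 1 := fun x hx => by
    have : ℓ.eval x = (b + a - 2 * x) / (b - a) := by
      simp only [ℓ, eval_sub, eval_mul, eval_C, eval_X]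
      ring
    rw [this, abs_div, abs_of_pos hba, div_le_one hba, abs_le]
    constructor <;> linarith [hx.1, hx.2]
  have hτ_ge : Real.exp (k / √(b / a)) / 2 ≤ τ := by
    have hℓ₀ : ℓ.eval 0 = (b / a + 1) / (b / a - 1) := by
      simp only [ℓ, eval_sub, eval_mul, eval_C, eval_X]
      field_simp
      ring
    rw [hτ, hℓ₀]
    exact exp_div_sqrt_div_two_le_eval_T ((one_lt_div ha).2 hab) k
  have hτ_pos : 0 < τ := (by positivity : 0 < Real.exp (k / √(b / a)) / 2).trans_le hτ_ge
  refine ⟨C τ⁻¹ * T.comp ℓ, ?_, ?_, fun x hx => ?_⟩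
  · calc (C τ⁻¹ * T.comp ℓ).natDegree ≤ (T.comp ℓ).natDegree := natDegree_C_mul_le _ _
      _ ≤ T.natDegree * ℓ.natDegree := natDegree_comp_le
      _ ≤ k * 1 := Nat.mul_le_mul (by simp [T]) (by simp only [ℓ]; compute_degree)
      _ = k := mul_one k
  · rw [eval_mul, eval_C, eval_comp, inv_mul_cancel₀ hτ_pos.ne']
  · rw [eval_mul, eval_C, eval_comp, abs_mul, abs_of_pos (inv_pos.2 hτ_pos)]
    calc τ⁻¹ * |T.eval (ℓ.eval x)| ≤ (Real.exp (k / √(b / a)) / 2)⁻¹ * 1 := by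
          gcongr
          exact Chebyshev.abs_eval_T_real_le_one k (hℓ x hx)
      _ = 2 * Real.exp (-(k / √(b / a))) := by
          rw [Real.exp_neg, inv_div, mul_one, div_eq_mul_inv]

theorem exists_polynomial_abs_one_sub_mul_le {a b : ℝ} (ha : 0 < a) (hab : a < b) {k : ℕ}
    (hk : 0 < k) :
    ∃ q : ℝ[X], q.natDegree < k ∧
      ∀ x ∈ Set.Icc a b, |1 - x * q.eval x| ≤ 2 * Real.exp (-(k / √(b / a))) := by
  obtain ⟨p, hpk, hp₀, hp⟩ := exists_polynomial_eval_zero_eq_one_abs_le ha hab k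
  refine ⟨-p.divX, ?_, fun x hx => ?_⟩
  · rw [natDegree_neg, natDegree_divX_eq_natDegree_tsub_one]
    lia
  · have hpx : p.eval x = 1 - x * (-p.divX).eval x := by
      conv_lhs => rw [← X_mul_divX_add p, coeff_zero_eq_eval_zero, hp₀]
      simp only [eval_add, eval_mul, eval_X, eval_C, eval_neg]
      ring
    exact hpx ▸ hp x hx

end Chebyshev

section CStarAlgebra

open Polynomial

variable {A : Type*} [CStarAlgebra A] [PartialOrder A] [StarOrderedRing A] {u : Aˣ}

theorem spectrum_subset_Icc_of_isStrictlyPositive (hu : IsStrictlyPositive (u : A)) :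
    spectrum ℝ (u : A) ⊆ Set.Icc ‖(↑u⁻¹ : A)‖⁻¹ ‖(u : A)‖ := by
  intro x hx
  have : Nontrivial A := by
    by_contra h
    rw [not_nontrivial_iff_subsingleton] at h
    simp [spectrum.of_subsingleton] at hx
  have hx_pos : 0 < x := hu.spectrum_pos hx
  have hx_inv : x⁻¹ ∈ spectrum ℝ (↑u⁻¹ : A) := spectrum.inv₀_mem_iff.2 (by simpa using hx)
  have hle := spectrum.norm_le_norm_of_mem hx
  have hle_inv := spectrum.norm_le_norm_of_mem hx_inv
  rw [Real.norm_of_nonneg hx_pos.le] at hle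
  rw [Real.norm_of_nonneg (inv_pos.2 hx_pos).le] at hle_inv
  exact ⟨inv_le_of_inv_le₀ hx_pos hle_inv, hle⟩

theorem exists_polynomial_abs_one_sub_mul_le_on_spectrum (hu : IsStrictlyPositive (u : A)) {κ : ℝ}
    (hκ : 1 < κ) (huκ : ‖(u : A)‖ * ‖(↑u⁻¹ : A)‖ ≤ κ) {k : ℕ} (hk : 0 < k) :
    ∃ q : ℝ[X], q.natDegree < k ∧
      ∀ x ∈ spectrum ℝ (u : A), |1 - x * q.eval x| ≤ 2 * Real.exp (-(k / √κ)) := by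
  rcases subsingleton_or_nontrivial A with hA | hA
  · exact ⟨0, by simpa using hk, fun x hx => by simp [spectrum.of_subsingleton] at hx⟩
  · set a := ‖(↑u⁻¹ : A)‖⁻¹
    have ha : 0 < a := inv_pos.2 (norm_pos_iff.2 u⁻¹.ne_zero)
    have hua : ‖(u : A)‖ ≤ κ * a := (le_mul_inv_iff₀ (inv_pos.1 ha)).2 huκ
    obtain ⟨q, hqk, hq⟩ :=
      exists_polynomial_abs_one_sub_mul_le ha (lt_mul_of_one_lt_left ha hκ) hk
    rw [mul_div_cancel_right₀ κ ha.ne'] at hq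
    exact ⟨q, hqk, fun x hx =>
      hq x (Set.Icc_subset_Icc_right hua (spectrum_subset_Icc_of_isStrictlyPositive hu hx))⟩

theorem star_inv_sub_aeval_mul_mul_le (hu : IsStrictlyPositive (u : A)) {q : ℝ[X]} {δ : ℝ}
    (hq : ∀ x ∈ spectrum ℝ (u : A), |1 - x * q.eval x| ≤ δ) :
    star (↑u⁻¹ - aeval (u : A) q) * u * (↑u⁻¹ - aeval (u : A) q) ≤ δ ^ 2 • (↑u⁻¹ : A) := by
  have : ContinuousOn (fun x : ℝ => x⁻¹) (spectrum ℝ (u : A)) :=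
    continuousOn_inv₀.mono fun x hx => (hu.spectrum_pos hx).ne'
  have hinv : (↑u⁻¹ : A) = cfc (fun x : ℝ => x⁻¹) (u : A) := (cfc_inv_id u).symm
  have herr : ↑u⁻¹ - aeval (u : A) q = cfc (fun x => x⁻¹ - q.eval x) (u : A) := by
    rw [hinv, ← cfc_polynomial q (u : A), cfc_sub ..]
  have hprod : star (↑u⁻¹ - aeval (u : A) q) * u * (↑u⁻¹ - aeval (u : A) q) =
      cfc (fun x => (x⁻¹ - q.eval x) * x * (x⁻¹ - q.eval x)) (u : A) := by
    rw [herr, (cfc_predicate _ _ : IsSelfAdjoint _).star_eq, cfc_mul .., cfc_mul ..,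
      cfc_id' ℝ (u : A)]
  rw [hprod, hinv, ← cfc_smul ..]
  refine cfc_mono fun x hx => ?_
  have hx_pos : 0 < x := hu.spectrum_pos hx
  calc (x⁻¹ - q.eval x) * x * (x⁻¹ - q.eval x) = |1 - x * q.eval x| ^ 2 * x⁻¹ := by
        rw [sq_abs]
        field_simp
    _ ≤ δ ^ 2 * x⁻¹ := by
        gcongr
        exact hq x hx

end CStarAlgebra

section Galerkin

open Matrix Polynomial
open scoped MatrixOrder

variable {R 𝕜 m n r : Type*} [CommRing R] [StarRing R] [RCLike 𝕜] [Fintype m] [Fintype n]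
  [DecidableEq m] [DecidableEq n]

/-- The Galerkin approximation of `Sᴴ * M⁻¹ * S` on the column space of `Q`: the solution `M⁻¹ * S`
is replaced by the matrix `Q * Y` for which the residual `S - M * (Q * Y)` is orthogonal to the
columns of `Q`. -/
noncomputable def galerkinEstimate (M : Matrix n n R) (Q : Matrix n m R) (S : Matrix n r R) :
    Matrix r r R :=
  (Qᴴ * S)ᴴ * (Qᴴ * M * Q)⁻¹ * (Qᴴ * S)

theorem conjTranspose_inv_mul_sub_mul_mul {M : Matrix n n R} (hM : M.IsHermitian)
    (hM_unit : IsUnit M) (S V : Matrix n r R) :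
    (M⁻¹ * S - V)ᴴ * M * (M⁻¹ * S - V) = Sᴴ * M⁻¹ * S - Sᴴ * V - Vᴴ * S + Vᴴ * M * V := by
  have hdet : IsUnit M.det := (isUnit_iff_isUnit_det M).1 hM_unit
  have hinv : M⁻¹ᴴ = M⁻¹ := hM.inv
  have hleft : (M⁻¹ * S - V)ᴴ * M = Sᴴ - Vᴴ * M := by
    rw [conjTranspose_sub, conjTranspose_mul, hinv, Matrix.sub_mul,
      nonsing_inv_mul_cancel_right _ _ hdet]
  rw [hleft, Matrix.sub_mul, Matrix.mul_sub, Matrix.mul_sub, Matrix.mul_assoc Vᴴ M (M⁻¹ * S),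
    mul_nonsing_inv_cancel_left _ _ hdet, ← Matrix.mul_assoc]
  abel

theorem sub_galerkinEstimate_add {M : Matrix n n R} (hM : M.IsHermitian) (hM_unit : IsUnit M)
    {Q : Matrix n m R} (hQ_unit : IsUnit (Qᴴ * M * Q)) (S : Matrix n r R) (V : Matrix m r R) :
    Sᴴ * M⁻¹ * S - galerkinEstimate M Q S +
      ((Qᴴ * M * Q)⁻¹ * (Qᴴ * S) - V)ᴴ * (Qᴴ * M * Q) * ((Qᴴ * M * Q)⁻¹ * (Qᴴ * S) - V) =
    (M⁻¹ * S - Q * V)ᴴ * M * (M⁻¹ * S - Q * V) := by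
  have hQ : (Qᴴ * M * Q).IsHermitian := isHermitian_conjTranspose_mul_mul Q hM
  rw [conjTranspose_inv_mul_sub_mul_mul hQ hQ_unit, conjTranspose_inv_mul_sub_mul_mul hM hM_unit]
  simp only [galerkinEstimate, conjTranspose_mul, conjTranspose_conjTranspose, Matrix.mul_assoc]
  abel

theorem galerkinEstimate_le [Finite r] {M : Matrix n n 𝕜} (hM : M.PosDef) {Q : Matrix n m 𝕜}
    (hQ : (Qᴴ * M * Q).PosDef) (S : Matrix n r 𝕜) :
    galerkinEstimate M Q S ≤ Sᴴ * M⁻¹ * S := by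
  have h := sub_galerkinEstimate_add hM.isHermitian hM.isUnit hQ.isUnit S
    ((Qᴴ * M * Q)⁻¹ * (Qᴴ * S))
  rw [sub_self, Matrix.mul_zero, add_zero] at h
  rw [← sub_nonneg, h]
  exact (hM.posSemidef.conjTranspose_mul_mul_same _).nonneg

theorem sub_galerkinEstimate_le [Finite r] {M : Matrix n n 𝕜} (hM : M.PosDef) {Q : Matrix n m 𝕜}
    (hQ : (Qᴴ * M * Q).PosDef) (S : Matrix n r 𝕜) (V : Matrix m r 𝕜) :
    Sᴴ * M⁻¹ * S - galerkinEstimate M Q S ≤ (M⁻¹ * S - Q * V)ᴴ * M * (M⁻¹ * S - Q * V) := by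
  rw [← sub_galerkinEstimate_add hM.isHermitian hM.isUnit hQ.isUnit S V]
  exact le_add_of_nonneg_right (hQ.posSemidef.conjTranspose_mul_mul_same _).nonneg

theorem conjTranspose_inv_mul_sub_aeval_mul_le [Finite r] {M : Matrix n n ℂ} (hM : M.PosDef)
    {q : ℝ[X]} {δ : ℝ} (hq : ∀ x ∈ spectrum ℝ M, |1 - x * q.eval x| ≤ δ) (S : Matrix n r ℂ) :
    (M⁻¹ * S - aeval M q * S)ᴴ * M * (M⁻¹ * S - aeval M q * S) ≤ δ ^ 2 • (Sᴴ * M⁻¹ * S) := by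
  have hle : (M⁻¹ - aeval M q)ᴴ * M * (M⁻¹ - aeval M q) ≤ δ ^ 2 • M⁻¹ := by
    have hpos := hM.isStrictlyPositive
    obtain ⟨u, rfl⟩ := hM.isUnit
    simpa only [coe_units_inv, star_eq_conjTranspose] using
      star_inv_sub_aeval_mul_mul_le hpos hq
  calc (M⁻¹ * S - aeval M q * S)ᴴ * M * (M⁻¹ * S - aeval M q * S)
      = Sᴴ * ((M⁻¹ - aeval M q)ᴴ * M * (M⁻¹ - aeval M q)) * S := by
        rw [← Matrix.sub_mul, conjTranspose_mul]
        simp only [Matrix.mul_assoc]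
    _ ≤ Sᴴ * (δ ^ 2 • M⁻¹) * S := by
        rw [← sub_nonneg, ← Matrix.sub_mul, ← Matrix.mul_sub]
        exact ((sub_nonneg.2 hle).posSemidef.conjTranspose_mul_mul_same S).nonneg
    _ = δ ^ 2 • (Sᴴ * M⁻¹ * S) := by rw [Matrix.mul_smul, Matrix.smul_mul]

theorem norm_galerkinEstimate_sub_le [Fintype r] [DecidableEq r] {M : Matrix n n ℂ}
    (hM : M.PosDef) {Q : Matrix n m ℂ} (hQ : Function.Injective Q.mulVec) {S : Matrix n r ℂ}
    {q : ℝ[X]} (hqQ : ∃ V : Matrix m r ℂ, aeval M q * S = Q * V)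
    {δ : ℝ} (hqM : ∀ x ∈ spectrum ℝ M, |1 - x * q.eval x| ≤ δ) :
    ‖galerkinEstimate M Q S - Sᴴ * M⁻¹ * S‖ ≤ δ ^ 2 * ‖Sᴴ * M⁻¹ * S‖ := by
  have hT : (Qᴴ * M * Q).PosDef := hM.conjTranspose_mul_mul_same hQ
  obtain ⟨V, hV⟩ := hqQ
  have hle : Sᴴ * M⁻¹ * S - galerkinEstimate M Q S ≤ δ ^ 2 • (Sᴴ * M⁻¹ * S) :=
    calc Sᴴ * M⁻¹ * S - galerkinEstimate M Q S
        ≤ (M⁻¹ * S - Q * V)ᴴ * M * (M⁻¹ * S - Q * V) := sub_galerkinEstimate_le hM hT S V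
      _ ≤ δ ^ 2 • (Sᴴ * M⁻¹ * S) := hV ▸ conjTranspose_inv_mul_sub_aeval_mul_le hM hqM S
  calc ‖galerkinEstimate M Q S - Sᴴ * M⁻¹ * S‖
      = ‖Sᴴ * M⁻¹ * S - galerkinEstimate M Q S‖ := norm_sub_rev _ _
    _ ≤ ‖δ ^ 2 • (Sᴴ * M⁻¹ * S)‖ :=
        CStarAlgebra.norm_le_norm_of_nonneg_of_le (sub_nonneg.2 (galerkinEstimate_le hM hT S)) hle
    _ = δ ^ 2 * ‖Sᴴ * M⁻¹ * S‖ := by rw [norm_smul, Real.norm_of_nonneg (sq_nonneg δ)]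

end Galerkin

section BlockKrylov

open Polynomial

variable {R E : Type*} [CommRing R] [AddCommGroup E] [Module R E]

/-- The block Krylov subspace `∑ j < k, A ^ j U`; for `U` the span of the columns of a block `B`,
it is the span of the columns of `B, A B, …, A ^ (k - 1) B`. -/
def blockKrylov (A : Module.End R E) (U : Submodule R E) (k : ℕ) : Submodule R E :=
  ⨆ j < k, U.map (A ^ j)

variable (A : Module.End R E) (U : Submodule R E)

@[simp]
theorem blockKrylov_zero : blockKrylov A U 0 = ⊥ := by simp [blockKrylov]

theorem blockKrylov_mono : Monotone (blockKrylov A U) := fun _ _ hkl =>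
  biSup_mono fun _ hj => hj.trans_le hkl

theorem blockKrylov_succ (k : ℕ) :
    blockKrylov A U (k + 1) = U ⊔ (blockKrylov A U k).map A := by
  simp only [blockKrylov, Nat.iSup_lt_succ', Submodule.map_iSup, ← Submodule.map_comp,
    ← Module.End.mul_eq_comp, ← pow_succ', pow_zero, Module.End.one_eq_id, Submodule.map_id]

theorem blockKrylov_one : blockKrylov A U 1 = U := by
  rw [blockKrylov_succ, blockKrylov_zero, Submodule.map_bot, sup_bot_eq]

theorem map_blockKrylov_le (k : ℕ) : (blockKrylov A U k).map A ≤ blockKrylov A U (k + 1) :=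
  le_sup_right.trans_eq (blockKrylov_succ A U k).symm

theorem blockKrylov_sup_map (k : ℕ) :
    blockKrylov A U (k + 1) ⊔ (blockKrylov A U (k + 1)).map A = blockKrylov A U (k + 2) := by
  refine le_antisymm (sup_le (blockKrylov_mono A U (by simp)) (map_blockKrylov_le A U _)) ?_
  rw [blockKrylov_succ A U (k + 1)]
  exact sup_le_sup_right (le_sup_left.trans_eq (blockKrylov_succ A U k).symm) _

variable {A U}

theorem aeval_apply_mem_blockKrylov {q : R[X]} {k : ℕ} (hq : q.natDegree < k) {x : E}
    (hx : x ∈ U) : aeval A q x ∈ blockKrylov A U k := by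
  rw [aeval_eq_sum_range' hq, LinearMap.sum_apply]
  refine Submodule.sum_mem _ fun j hj => Submodule.smul_mem _ _ ?_
  exact le_iSup₂ (f := fun j (_ : j < k) => U.map (A ^ j)) j (Finset.mem_range.1 hj)
    (Submodule.mem_map_of_mem hx)

end BlockKrylov

section ListSpan

variable {R E : Type*} [Ring R] [AddCommGroup E] [Module R E]

variable (R) in
/-- The span of the members of a list, in the form in which the bases produced by the algorithm
are handled. -/
def listSpan (Q : List E) : Submodule R E :=
  Submodule.span R {v | v ∈ Q}

@[simp]
theorem listSpan_nil : listSpan R ([] : List E) = ⊥ := by simp [listSpan]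

@[simp]
theorem listSpan_append (Q W : List E) : listSpan R (Q ++ W) = listSpan R Q ⊔ listSpan R W := by
  simp only [listSpan, ← Submodule.span_union, List.mem_append, Set.ofPred_or]

theorem listSpan_singleton (v : E) : listSpan R [v] = R ∙ v := by simp [listSpan]

theorem map_listSpan {F : Type*} [AddCommGroup F] [Module R F] (A : E →ₗ[R] F) (Q : List E) :
    (listSpan R Q).map A = listSpan R (Q.map A) := by
  simp [listSpan, Submodule.map_span, Set.image]

theorem sup_span_singleton_sub {U : Submodule R E} {p : E} (hp : p ∈ U) (w : E) :
    U ⊔ R ∙ (w - p) = U ⊔ R ∙ w := by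
  refine le_antisymm (sup_le le_sup_left ?_) (sup_le le_sup_left ?_)
  · exact (Submodule.span_singleton_le_iff_mem _ _).2 (sub_mem
      (Submodule.mem_sup_right (Submodule.mem_span_singleton_self w)) (Submodule.mem_sup_left hp))
  · have hadd : w - p + p ∈ U ⊔ R ∙ (w - p) :=
      add_mem (Submodule.mem_sup_right (Submodule.mem_span_singleton_self (w - p)))
        (Submodule.mem_sup_left hp)
    rwa [Submodule.span_singleton_le_iff_mem, ← sub_add_cancel w p, add_sub_cancel_right]

end ListSpan

section GramSchmidt

variable {𝕜 E : Type*} [RCLike 𝕜] [NormedAddCommGroup E] [InnerProductSpace 𝕜 E]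

theorem orthonormal_get_iff {Q : List E} :
    Orthonormal 𝕜 Q.get ↔ (∀ q ∈ Q, ‖q‖ = 1) ∧ Q.Pairwise fun x y => inner 𝕜 x y = 0 := by
  rw [Orthonormal, ← List.forall_mem_iff_get (p := fun q => ‖q‖ = 1)]
  refine and_congr_right fun _ => ⟨fun h => ?_, fun h i j hij => ?_⟩
  · exact List.pairwise_iff_get.2 fun i j hij => h hij.ne
  · rcases hij.lt_or_gt with hlt | hgt
    · exact List.pairwise_iff_get.1 h i j hlt
    · exact inner_eq_zero_symm.1 (List.pairwise_iff_get.1 h j i hgt)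

theorem orthonormal_get_concat {Q : List E} (hQ : Orthonormal 𝕜 Q.get) {v : E} (hv : ‖v‖ = 1)
    (hQv : ∀ q ∈ Q, inner 𝕜 q v = 0) : Orthonormal 𝕜 (Q ++ [v]).get := by
  rw [orthonormal_get_iff] at hQ ⊢
  simp only [List.forall_mem_append, List.forall_mem_singleton, List.pairwise_append,
    List.pairwise_singleton, true_and]
  exact ⟨⟨hQ.1, hv⟩, hQ.2, hQv⟩

variable (𝕜) in
/-- The remainder of `w` after subtraction of its components along the members of `Q`, from which
one step of Gram–Schmidt makes the next basis vector. -/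
def gramSchmidtRemainder (Q : List E) (w : E) : E :=
  w - (Q.map fun q => inner 𝕜 q w • q).sum

theorem inner_gramSchmidtRemainder {Q : List E} (hQ : Orthonormal 𝕜 Q.get) (w : E) {q : E}
    (hq : q ∈ Q) : inner 𝕜 q (gramSchmidtRemainder 𝕜 Q w) = 0 := by
  obtain ⟨i, rfl⟩ := List.get_of_mem hq
  have hsum : (Q.map fun q => inner 𝕜 q w • q).sum = ∑ j, inner 𝕜 (Q.get j) w • Q.get j := by
    conv_lhs => rw [← List.ofFn_get Q, List.map_ofFn, List.sum_ofFn]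
    rfl
  rw [gramSchmidtRemainder, hsum, inner_sub_right, hQ.inner_right_fintype, sub_self]

theorem listSpan_sup_span_gramSchmidtRemainder (Q : List E) (w : E) :
    listSpan 𝕜 Q ⊔ 𝕜 ∙ gramSchmidtRemainder 𝕜 Q w = listSpan 𝕜 Q ⊔ 𝕜 ∙ w := by
  have hproj : (Q.map fun q => inner 𝕜 q w • q).sum ∈ listSpan 𝕜 Q :=
    list_sum_mem fun x hx => by
      obtain ⟨q, hq, rfl⟩ := List.mem_map.1 hx
      exact Submodule.smul_mem _ _ (Submodule.subset_span hq)
  exact sup_span_singleton_sub hproj w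

theorem span_singleton_normalize {F : Type*} [NormedAddCommGroup F] [NormedSpace ℂ F] (x : F) :
    ℂ ∙ NormedSpace.normalize x = ℂ ∙ x := by
  rcases eq_or_ne x 0 with rfl | hx
  · rw [NormedSpace.normalize_zero_eq_zero]
  · have hunit : IsUnit ((‖x‖⁻¹ : ℝ) : ℂ) := by simpa using hx
    exact Submodule.span_singleton_smul_eq hunit x

end GramSchmidt

namespace MatVecAlgorithm

variable {n : ℕ} {α β : Type} (M : Matrix (Fin n) (Fin n) ℂ)

@[simp]
theorem result_bind (a : MatVecAlgorithm n α) (f : α → MatVecAlgorithm n β) :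
    (a.bind f).result M = (f (a.result M)).result M := by
  induction a with
  | done a => rfl
  | product v _ ih => exact ih _

@[simp]
theorem numProducts_bind (a : MatVecAlgorithm n α) (f : α → MatVecAlgorithm n β) :
    (a.bind f).numProducts M = a.numProducts M + (f (a.result M)).numProducts M := by
  induction a with
  | done a => simp only [bind, numProducts, result, zero_add]
  | product v _ ih =>
    simp only [bind, numProducts, result, ih]
    lia

@[simp]
theorem result_multiplyAll (Q : List (EuclideanSpace ℂ (Fin n))) :
    (multiplyAll Q).result M = Q.map fun q => (q, Matrix.toEuclideanLin M q) := by
  induction Q with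
  | nil => rfl
  | cons q Q ih => simp [multiplyAll, result, ih]

@[simp]
theorem numProducts_multiplyAll (Q : List (EuclideanSpace ℂ (Fin n))) :
    (multiplyAll Q).numProducts M = Q.length := by
  induction Q with
  | nil => rfl
  | cons q Q ih => simp [multiplyAll, numProducts, ih]

end MatVecAlgorithm

namespace BlockLanczos

variable {n : ℕ}

theorem orthonormalize_cons_of_eq_zero {Q : List (EuclideanSpace ℂ (Fin n))}
    {w : EuclideanSpace ℂ (Fin n)} (hw : gramSchmidtRemainder ℂ Q w = 0)
    (W : List (EuclideanSpace ℂ (Fin n))) :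
    orthonormalize Q (w :: W) = orthonormalize Q W := by
  rw [orthonormalize]
  exact if_pos hw

theorem orthonormalize_cons_of_ne_zero {Q : List (EuclideanSpace ℂ (Fin n))}
    {w : EuclideanSpace ℂ (Fin n)} (hw : gramSchmidtRemainder ℂ Q w ≠ 0)
    (W : List (EuclideanSpace ℂ (Fin n))) :
    orthonormalize Q (w :: W) =
      NormedSpace.normalize (gramSchmidtRemainder ℂ Q w) ::
        orthonormalize (Q ++ [NormedSpace.normalize (gramSchmidtRemainder ℂ Q w)]) W := by
  rw [orthonormalize]
  exact if_neg hw

theorem length_orthonormalize_le (Q W : List (EuclideanSpace ℂ (Fin n))) :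
    (orthonormalize Q W).length ≤ W.length := by
  induction W generalizing Q with
  | nil => rfl
  | cons w W ih =>
    by_cases hw : gramSchmidtRemainder ℂ Q w = 0
    · rw [orthonormalize_cons_of_eq_zero hw]
      exact (ih Q).trans (Nat.le_succ _)
    · rw [orthonormalize_cons_of_ne_zero hw]
      exact Nat.succ_le_succ (ih _)

theorem orthonormal_append_orthonormalize {Q : List (EuclideanSpace ℂ (Fin n))}
    (hQ : Orthonormal ℂ Q.get) (W : List (EuclideanSpace ℂ (Fin n))) :
    Orthonormal ℂ (Q ++ orthonormalize Q W).get := by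
  induction W generalizing Q with
  | nil => rwa [orthonormalize, List.append_nil]
  | cons w W ih =>
    by_cases hw : gramSchmidtRemainder ℂ Q w = 0
    · rw [orthonormalize_cons_of_eq_zero hw]
      exact ih hQ
    · rw [orthonormalize_cons_of_ne_zero hw, List.append_cons]
      refine ih (orthonormal_get_concat hQ (NormedSpace.norm_normalize_eq_one_iff.2 hw) ?_)
      intro q hq
      exact (inner_smul_right _ _ _).trans
        (by rw [inner_gramSchmidtRemainder hQ w hq, mul_zero])

theorem listSpan_append_orthonormalize (Q W : List (EuclideanSpace ℂ (Fin n))) :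
    listSpan ℂ (Q ++ orthonormalize Q W) = listSpan ℂ Q ⊔ listSpan ℂ W := by
  induction W generalizing Q with
  | nil => rw [orthonormalize, List.append_nil, listSpan_nil, sup_bot_eq]
  | cons w W ih =>
    have hcons : listSpan ℂ Q ⊔ listSpan ℂ (w :: W) =
        (listSpan ℂ Q ⊔ ℂ ∙ gramSchmidtRemainder ℂ Q w) ⊔ listSpan ℂ W := by
      rw [listSpan_sup_span_gramSchmidtRemainder, ← List.singleton_append, listSpan_append,
        listSpan_singleton, sup_assoc]
    rw [hcons]
    by_cases hw : gramSchmidtRemainder ℂ Q w = 0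
    · rw [orthonormalize_cons_of_eq_zero hw, ih, hw, Submodule.span_zero_singleton, sup_bot_eq]
    · rw [orthonormalize_cons_of_ne_zero hw, List.append_cons, ih, listSpan_append,
        listSpan_singleton, span_singleton_normalize]

theorem numProducts_iterate_le (M : Matrix (Fin n) (Fin n) ℂ) (k : ℕ)
    (P : List (EuclideanSpace ℂ (Fin n) × EuclideanSpace ℂ (Fin n)))
    (W : List (EuclideanSpace ℂ (Fin n))) :
    (iterate k P W).numProducts M ≤ k * W.length := by
  induction k generalizing P W with
  | zero => exact Nat.zero_le _
  | succ k ih =>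
    simp only [iterate, MatVecAlgorithm.numProducts_bind, MatVecAlgorithm.result_multiplyAll,
      MatVecAlgorithm.numProducts_multiplyAll]
    set N := orthonormalize (P.map Prod.fst) W
    have hN : N.length ≤ W.length := length_orthonormalize_le _ _
    calc N.length + (iterate k _ _).numProducts M ≤ N.length + k * N.length := by
          gcongr
          exact (ih _ _).trans_eq (by rw [List.length_map, List.length_map])
      _ = (k + 1) * N.length := by ring
      _ ≤ (k + 1) * W.length := by gcongr

/-- The basis built by `k` iterations of block Lanczos, without the oracle bookkeeping: the first
components of the pairs returned by `iterate` (see `result_iterate`). -/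
noncomputable def lanczosBasis (M : Matrix (Fin n) (Fin n) ℂ) :
    ℕ → List (EuclideanSpace ℂ (Fin n)) → List (EuclideanSpace ℂ (Fin n)) →
      List (EuclideanSpace ℂ (Fin n))
  | 0, Q, _ => Q
  | k + 1, Q, W =>
    lanczosBasis M k (Q ++ orthonormalize Q W)
      ((orthonormalize Q W).map (Matrix.toEuclideanLin M))

variable (M : Matrix (Fin n) (Fin n) ℂ)

theorem result_iterate (k : ℕ) (Q W : List (EuclideanSpace ℂ (Fin n))) :
    (iterate k (Q.map fun q => (q, Matrix.toEuclideanLin M q)) W).result M =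
      (lanczosBasis M k Q W).map fun q => (q, Matrix.toEuclideanLin M q) := by
  induction k generalizing Q W with
  | zero => rfl
  | succ k ih =>
    simp only [iterate, MatVecAlgorithm.result_bind, MatVecAlgorithm.result_multiplyAll,
      List.map_map, Function.comp_def, List.map_id', ← List.map_append]
    exact ih _ _

theorem orthonormal_lanczosBasis (k : ℕ) {Q : List (EuclideanSpace ℂ (Fin n))}
    (hQ : Orthonormal ℂ Q.get) (W : List (EuclideanSpace ℂ (Fin n))) :
    Orthonormal ℂ (lanczosBasis M k Q W).get := by
  induction k generalizing Q W with
  | zero => exact hQ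
  | succ _ ih => exact ih (orthonormal_append_orthonormalize hQ W) _

theorem listSpan_lanczosBasis (k : ℕ) {j : ℕ} {Q W : List (EuclideanSpace ℂ (Fin n))}
    {U : Submodule ℂ (EuclideanSpace ℂ (Fin n))}
    (hQ : listSpan ℂ Q = blockKrylov (Matrix.toEuclideanLin M) U j)
    (hW : listSpan ℂ Q ⊔ listSpan ℂ W = blockKrylov (Matrix.toEuclideanLin M) U (j + 1)) :
    listSpan ℂ (lanczosBasis M k Q W) = blockKrylov (Matrix.toEuclideanLin M) U (j + k) := by
  induction k generalizing j Q W with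
  | zero => exact hQ
  | succ k ih =>
    set A := Matrix.toEuclideanLin M
    set N := orthonormalize Q W
    have hQN : listSpan ℂ (Q ++ N) = blockKrylov A U (j + 1) :=
      (listSpan_append_orthonormalize Q W).trans hW
    rw [show j + (k + 1) = j + 1 + k by lia]
    refine ih hQN ?_
    have hAQ : (listSpan ℂ Q).map A ≤ listSpan ℂ (Q ++ N) := by
      rw [hQ, hQN]
      exact map_blockKrylov_le A U j
    calc listSpan ℂ (Q ++ N) ⊔ listSpan ℂ (N.map A)
        = listSpan ℂ (Q ++ N) ⊔ (listSpan ℂ (Q ++ N)).map A := by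
          rw [listSpan_append Q N, Submodule.map_sup, map_listSpan A N, ← sup_assoc,
            ← listSpan_append, sup_eq_left.2 hAQ]
      _ = blockKrylov A U (j + 2) := by rw [hQN, blockKrylov_sup_map]

end BlockLanczos

section ColMatrix

open Matrix

variable {𝕜 n ι κ : Type*}

/-- The matrix with columns `B a`, which turns families of vectors into the blocks of the block
Lanczos algorithm. -/
def colMatrix (B : ι → EuclideanSpace 𝕜 n) : Matrix n ι 𝕜 :=
  Matrix.of fun i a => B a i

@[simp]
theorem colMatrix_apply (B : ι → EuclideanSpace 𝕜 n) (i : n) (a : ι) : colMatrix B i a = B a i :=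
  rfl

variable [RCLike 𝕜]

theorem exists_colMatrix_eq_mul [Fintype κ] {B : κ → EuclideanSpace 𝕜 n}
    {D : ι → EuclideanSpace 𝕜 n} (h : ∀ i, D i ∈ Submodule.span 𝕜 (Set.range B)) :
    ∃ V : Matrix κ ι 𝕜, colMatrix D = colMatrix B * V := by
  choose c hc using fun i => (Submodule.mem_span_range_iff_exists_fun 𝕜).1 (h i)
  refine ⟨Matrix.of fun a i => c i a, ?_⟩
  ext j i
  simp [Matrix.mul_apply, ← hc, mul_comm]

theorem mulVec_colMatrix_injective [Fintype ι] {B : ι → EuclideanSpace 𝕜 n}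
    (hB : LinearIndependent 𝕜 B) : Function.Injective (colMatrix B).mulVec :=
  mulVec_injective_iff.2 (hB.map' (WithLp.linearEquiv 2 𝕜 (n → 𝕜)).toLinearMap (LinearEquiv.ker _))

theorem conjTranspose_colMatrix_mul_mul_single [Fintype n] [DecidableEq n] (A : Matrix n n 𝕜)
    (s : ι → n) :
    (colMatrix fun i => EuclideanSpace.single (s i) (1 : 𝕜))ᴴ * A *
      (colMatrix fun i => EuclideanSpace.single (s i) (1 : 𝕜)) = A.submatrix s s := by
  ext i j
  simp [Matrix.mul_apply]

variable [Fintype n]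

theorem conjTranspose_colMatrix_mul_apply (B : ι → EuclideanSpace 𝕜 n)
    (D : κ → EuclideanSpace 𝕜 n) (a : ι) (i : κ) :
    ((colMatrix B)ᴴ * colMatrix D) a i = inner 𝕜 (B a) (D i) := by
  simp [Matrix.mul_apply, PiLp.inner_apply, mul_comm]

theorem mul_colMatrix [DecidableEq n] (A : Matrix n n 𝕜) (B : ι → EuclideanSpace 𝕜 n) :
    A * colMatrix B = colMatrix fun i => Matrix.toEuclideanLin A (B i) := by
  ext i a
  simp [Matrix.mul_apply, Matrix.toLpLin_apply, Matrix.mulVec, dotProduct]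

end ColMatrix

section BlockLanczosError

open Matrix Polynomial BlockLanczos

variable {n r : ℕ} (M : Matrix (Fin n) (Fin n) ℂ) (B : Fin r → EuclideanSpace ℂ (Fin n)) (k : ℕ)

theorem estimate_map_eq_galerkinEstimate (Q : List (EuclideanSpace ℂ (Fin n))) :
    estimate B (Q.map fun q => (q, toEuclideanLin M q)) =
      galerkinEstimate M (colMatrix Q.get) (colMatrix B) := by
  set P := Q.map fun q => (q, toEuclideanLin M q) with hP
  let e : Fin P.length ≃ Fin Q.length := finCongr (by simp [hP])
  have hT : (Matrix.of fun a b => inner ℂ (P.get a).1 (P.get b).2) =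
      ((colMatrix Q.get)ᴴ * M * colMatrix Q.get).submatrix e e := by
    ext a b
    rw [submatrix_apply, Matrix.mul_assoc, mul_colMatrix, conjTranspose_colMatrix_mul_apply]
    simp [hP, e]
  have hQB : (Matrix.of fun a i => inner ℂ (P.get a).1 (B i)) =
      ((colMatrix Q.get)ᴴ * colMatrix B).submatrix e id := by
    ext a i
    rw [submatrix_apply, conjTranspose_colMatrix_mul_apply]
    simp [hP, e]
  rw [estimate, hT, hQB, conjTranspose_submatrix, inv_submatrix_equiv, submatrix_mul_equiv,
    submatrix_mul_equiv, submatrix_id_id, galerkinEstimate]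

theorem result_blockLanczos :
    (blockLanczos B k).result M =
      galerkinEstimate M (colMatrix (lanczosBasis M k [] (List.ofFn B)).get) (colMatrix B) := by
  rw [blockLanczos, MatVecAlgorithm.result_bind, ← estimate_map_eq_galerkinEstimate,
    ← result_iterate]
  rfl

theorem numProducts_blockLanczos_le : (blockLanczos B k).numProducts M ≤ k * r := by
  simpa [blockLanczos, MatVecAlgorithm.numProducts] using
    numProducts_iterate_le M k [] (List.ofFn B)

variable {M k}

theorem toEuclideanLin_aeval (q : ℝ[X]) :
    toEuclideanLin (aeval M q) = aeval (toEuclideanLin M) (q.map (algebraMap ℝ ℂ)) := by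
  rw [← aeval_map_algebraMap ℂ M q]
  exact (aeval_algHom_apply (toLpLinAlgEquiv (R := ℂ) 2) M _).symm

theorem toEuclideanLin_aeval_mem_blockKrylov {q : ℝ[X]} (hqk : q.natDegree < k)
    {U : Submodule ℂ (EuclideanSpace ℂ (Fin n))} {v : EuclideanSpace ℂ (Fin n)} (hv : v ∈ U) :
    toEuclideanLin (aeval M q) v ∈ blockKrylov (toEuclideanLin M) U k :=
  toEuclideanLin_aeval (M := M) q ▸ aeval_apply_mem_blockKrylov (natDegree_map_le.trans_lt hqk) hv

theorem span_lanczosBasis_ofFn :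
    Submodule.span ℂ (Set.range (lanczosBasis M k [] (List.ofFn B)).get) =
      blockKrylov (toEuclideanLin M) (listSpan ℂ (List.ofFn B)) k := by
  have h := listSpan_lanczosBasis M k (j := 0) (Q := []) (W := List.ofFn B)
    (U := listSpan ℂ (List.ofFn B)) (by simp) (by simp [blockKrylov_one])
  rwa [zero_add, listSpan, ← Set.range_list_get] at h

theorem norm_result_blockLanczos_sub_le (hM : M.PosDef) {q : ℝ[X]} (hqk : q.natDegree < k) {δ : ℝ}
    (hqM : ∀ x ∈ spectrum ℝ M, |1 - x * q.eval x| ≤ δ) :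
    ‖(blockLanczos B k).result M - (colMatrix B)ᴴ * M⁻¹ * colMatrix B‖ ≤
      δ ^ 2 * ‖(colMatrix B)ᴴ * M⁻¹ * colMatrix B‖ := by
  have horth : Orthonormal ℂ (lanczosBasis M k [] (List.ofFn B)).get :=
    orthonormal_lanczosBasis M k (orthonormal_get_iff.2 (by simp)) _
  have hmem (i : Fin r) : toEuclideanLin (aeval M q) (B i) ∈
      Submodule.span ℂ (Set.range (lanczosBasis M k [] (List.ofFn B)).get) := by
    rw [span_lanczosBasis_ofFn]
    exact toEuclideanLin_aeval_mem_blockKrylov hqk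
      (Submodule.subset_span (List.mem_ofFn.2 ⟨i, rfl⟩))
  rw [result_blockLanczos]
  refine norm_galerkinEstimate_sub_le hM (mulVec_colMatrix_injective horth.linearIndependent) ?_ hqM
  rw [mul_colMatrix]
  exact exists_colMatrix_eq_mul hmem

open scoped MatrixOrder in
theorem exists_polynomial_of_conditionNumber_le (hM : M.PosDef) {κ : ℝ} (hκ : 1 < κ)
    (hMκ : conditionNumber M ≤ κ) (hk : 0 < k) :
    ∃ q : ℝ[X], q.natDegree < k ∧
      ∀ x ∈ spectrum ℝ M, |1 - x * q.eval x| ≤ 2 * Real.exp (-(k / √κ)) := by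
  have hpos := hM.isStrictlyPositive
  rw [conditionNumber] at hMκ
  obtain ⟨u, rfl⟩ := hM.isUnit
  rw [← coe_units_inv] at hMκ
  exact exists_polynomial_abs_one_sub_mul_le_on_spectrum hpos hκ hMκ hk

theorem norm_result_blockLanczos_sub_le_of_conditionNumber_le (hM : M.PosDef) {κ : ℝ} (hκ : 1 < κ)
    (hMκ : conditionNumber M ≤ κ) (hk : 0 < k) :
    ‖(blockLanczos B k).result M - (colMatrix B)ᴴ * M⁻¹ * colMatrix B‖ ≤
      (2 * Real.exp (-(k / √κ))) ^ 2 * ‖(colMatrix B)ᴴ * M⁻¹ * colMatrix B‖ := by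
  obtain ⟨q, hqk, hq⟩ := exists_polynomial_of_conditionNumber_le hM hκ hMκ hk
  exact norm_result_blockLanczos_sub_le B hM hqk hq

end BlockLanczosError

section IterationCount

variable {κ ε : ℝ}

theorem natCeil_three_mul_sqrt_mul_log_le (hκ : 1 ≤ κ) (hε : 0 < ε) (hε_half : ε ≤ 1 / 2) :
    (⌈3 * √κ * Real.log (1 / ε)⌉₊ : ℝ) ≤ 5 * (√κ * Real.log (1 / ε)) := by
  have hsqrt : 1 ≤ √κ := Real.one_le_sqrt.2 hκ
  have hlog : 1 / 2 ≤ Real.log (1 / ε) :=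
    calc (1 / 2 : ℝ) ≤ Real.log 2 := by linarith [Real.log_two_gt_d9]
      _ ≤ Real.log (1 / ε) :=
        Real.log_le_log two_pos ((le_div_iff₀ hε).2 (by linarith))
  have hprod : 1 * (1 / 2) ≤ √κ * Real.log (1 / ε) := by gcongr
  have hceil := Nat.ceil_lt_add_one (show 0 ≤ 3 * √κ * Real.log (1 / ε) by positivity)
  linarith

theorem sq_two_mul_exp_neg_div_sqrt_le (hκ : 0 < κ) (hε : 0 < ε) (hε_half : ε ≤ 1 / 2) {k : ℕ}
    (hk : 3 * √κ * Real.log (1 / ε) ≤ k) :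
    (2 * Real.exp (-(k / √(4 * κ)))) ^ 2 ≤ ε := by
  have hsqrt : √(4 * κ) = 2 * √κ := by
    rw [show 4 * κ = 2 ^ 2 * κ by ring, Real.sqrt_mul (by positivity), Real.sqrt_sq zero_le_two]
  have hk' : Real.log (1 / ε) * 3 ≤ k / √κ := (le_div_iff₀ (Real.sqrt_pos.2 hκ)).2 (by linarith)
  calc (2 * Real.exp (-(k / √(4 * κ)))) ^ 2 = 4 * Real.exp (-(k / √κ)) := by
        rw [mul_pow, ← Real.exp_nat_mul, hsqrt]
        ring_nf
    _ ≤ 4 * Real.exp (Real.log ε * 3) := by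
        rw [one_div, Real.log_inv] at hk'
        gcongr
        linarith
    _ = 4 * ε ^ 2 * ε := by
        rw [Real.exp_mul, Real.exp_log hε]
        norm_cast
        ring
    _ ≤ ε := by nlinarith

end IterationCount

open Matrix in
theorem theorem2p7_general :
    ∃ C : ℝ, 0 < C ∧ ∀ κ ε : ℝ, 1 ≤ κ → 0 < ε → ε ≤ 1 / 2 →
      ∃ k : ℕ, ∀ (n r : ℕ) (B : Fin r → EuclideanSpace ℂ (Fin n)) (M : Matrix (Fin n) (Fin n) ℂ),
        M.PosDef → conditionNumber M ≤ κ →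
          (((blockLanczos B k).numProducts M : ℕ) : ℝ) ≤ C * (r * √κ * Real.log (1 / ε)) ∧
          ‖(blockLanczos B k).result M - (colMatrix B)ᴴ * M⁻¹ * colMatrix B‖ ≤
            ε * ‖(colMatrix B)ᴴ * M⁻¹ * colMatrix B‖ := by
  refine ⟨5, by norm_num, fun κ ε hκ hε hε_half =>
    ⟨⌈3 * √κ * Real.log (1 / ε)⌉₊, fun n r B M hM hMκ => ⟨?_, ?_⟩⟩⟩
  · set k := ⌈3 * √κ * Real.log (1 / ε)⌉₊
    calc ((blockLanczos B k).numProducts M : ℝ) ≤ k * r := by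
          exact_mod_cast numProducts_blockLanczos_le M B k
      _ ≤ 5 * (√κ * Real.log (1 / ε)) * r := by
          gcongr
          exact natCeil_three_mul_sqrt_mul_log_le hκ hε hε_half
      _ = 5 * (r * √κ * Real.log (1 / ε)) := by ring
  · have hlog : 0 < Real.log (1 / ε) := Real.log_pos ((one_lt_div hε).2 (by linarith))
    -- The bound `4 * κ` instead of `κ` keeps the Chebyshev interval nondegenerate when `κ = 1`.
    refine (norm_result_blockLanczos_sub_le_of_conditionNumber_le B hM (κ := 4 * κ) (by linarith)
      (by linarith) (Nat.ceil_pos.2 (by positivity))).trans ?_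
    gcongr
    exact sq_two_mul_exp_neg_div_sqrt_le (by linarith) hε hε_half (Nat.le_ceil _)

theorem theorem2p7 :
    ∃ C : ℝ, 0 < C ∧ ∀ κ ε : ℝ, 1 ≤ κ → 0 < ε → ε ≤ 1 / 2 →
      ∃ k : ℕ, ∀ (n r : ℕ) (s : Fin r ↪ Fin n) (M : Matrix (Fin n) (Fin n) ℂ),
        M.PosDef → conditionNumber M ≤ κ →
          (((blockLanczos (fun i => EuclideanSpace.single (s i) (1 : ℂ)) k).numProducts M : ℕ) : ℝ)
              ≤ C * (r * √κ * Real.log (1 / ε)) ∧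
          ‖(blockLanczos (fun i => EuclideanSpace.single (s i) (1 : ℂ)) k).result M
              - M⁻¹.submatrix s s‖ ≤ ε * ‖M⁻¹.submatrix s s‖ := by
  obtain ⟨C, hC, h⟩ := theorem2p7_general
  refine ⟨C, hC, fun κ ε hκ hε hε_half =>
    (h κ ε hκ hε hε_half).imp fun k hk n r s M hM hMκ => ?_⟩
  rw [← conjTranspose_colMatrix_mul_mul_single]
  exact hk n r _ M hM hMκ
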